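/- Consider finite words over the binary alphabet $\Sigma=\{a,b\}$; $|u|$ denotes the length of a word $u$ and $|u|_a$ its number of occurrences of $a$. A word is Sturmian if it is balanced: $\big||u|_a-|v|_a\big|\le 1$ for any two of its factors $u,v$ of the same length. A bispecial Sturmian word is a Sturmian word $w$ such that $aw$, $bw$, $wa$ and $wb$ are all Sturmian. For integers $p,q>0$ and $n=p+q$, the lower Christoffel word $w_{p,q}$ is the word of length $n$ whose $i$-th letter ($1\le i\le n$) is $a$ if $iq \bmod n>(i-1)q\bmod n$ and $b$ if $iq \bmod n<(i-1)q\bmod n$; the upper Christoffel word $w'_{p,q}$ is the word of length $n$ whose $i$-th letter is $a$ if $ip\bmod n<(i-1)p\bmod n$ and $b$ if $ip\bmod n>(i-1)p\bmod n$. A Christoffel word is a lower or upper Christoffel word for some $p,q>0$, coprime or not (so it may be primitive or not). A central word is a word of length $p+q-2$ having two coprime positive integers $p,q$ as periods, where a positive integer $p$ is a period of $w$ if any two letters of $w$ at distance $p$ are equal. Theorem. A word $w$ over $\Sigma$ is a bispecial Sturmian word if and only if $xwy$ is a Christoffel word for some letters $x,y\in\Sigma$. Equivalently, the bispecial Sturmian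 words are exactly the words $(uyx)^n u$ with $u$ a central word, $n\ge 0$ an integer and $x\ne y$ letters of $\Sigma$. -/

import Mathlib

namespace Words

/-- The binary alphabet `Σ = {a, b}`. -/
inductive Letter where
  | a
  | b
  deriving DecidableEq

/-- Finite words over `{a, b}`. -/
abbrev Word := List Letter

/-- A word is Sturmian when it is balanced: any two of its factors of the same length differ by at
most one in their number of occurrences of the letter `a`. -/
def IsSturmian (w : Word) : Prop :=
  ∀ u v : Word, u <:+: w → v <:+: w → u.length = v.length →
    |(u.count Letter.a : ℤ) - (v.count Letter.a : ℤ)| ≤ 1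

/-- A left special Sturmian word. -/
def IsLeftSpecial (w : Word) : Prop :=
  IsSturmian w ∧ IsSturmian ([Letter.a] ++ w) ∧ IsSturmian ([Letter.b] ++ w)

/-- A right special Sturmian word. -/
def IsRightSpecial (w : Word) : Prop :=
  IsSturmian w ∧ IsSturmian (w ++ [Letter.a]) ∧ IsSturmian (w ++ [Letter.b])

/-- The set `BS` of bispecial Sturmian words. -/
def BS : Set Word := {w | IsLeftSpecial w ∧ IsRightSpecial w}

/-- The lower Christoffel word `w_{p,q}` (meaningful for `p, q > 0`): with `n = p + q`, its letter
with (zero-based) index `i < n` is `a` if `(i + 1) q mod n > i q mod n` and `b` otherwise. For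
`p, q > 0` the two residues are never equal. -/
def lowerChristoffel (p q : ℕ) : Word :=
  (List.range (p + q)).map fun i =>
    if ((i + 1) * q) % (p + q) > (i * q) % (p + q) then Letter.a else Letter.b

/-- The upper Christoffel word `w'_{p,q}` (meaningful for `p, q > 0`): with `n = p + q`, its letter
with (zero-based) index `i < n` is `a` if `(i + 1) p mod n < i p mod n` and `b` otherwise. -/
def upperChristoffel (p q : ℕ) : Word :=
  (List.range (p + q)).map fun i =>
    if ((i + 1) * p) % (p + q) < (i * p) % (p + q) then Letter.a else Letter.b

/-- A Christoffel word is a lower or an upper Christoffel word `w_{p,q}`, `w'_{p,q}` with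
`p, q > 0`; the integers `p` and `q` need not be coprime. -/
def IsChristoffel (w : Word) : Prop :=
  ∃ p q : ℕ, 0 < p ∧ 0 < q ∧ (w = lowerChristoffel p q ∨ w = upperChristoffel p q)

/-- `p` is a period of `w`: it is positive and `w[i] = w[i + p]` whenever both are defined (which
holds vacuously if `p` is at least the length of `w`; see `List.hasPeriod_iff_getElem?`). -/
def IsPeriod (w : Word) (p : ℕ) : Prop := 0 < p ∧ List.HasPeriod w p

/-- A central word: it has two coprime periods `p`, `q` and its length is `p + q - 2`. -/
def IsCentral (w : Word) : Prop :=
  ∃ p q : ℕ, IsPeriod w p ∧ IsPeriod w q ∧ Nat.Coprime p q ∧ w.length + 2 = p + q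

/-- The power `v ^ n` of a word: the concatenation of `n` copies of `v`. -/
def wordPow (v : Word) (n : ℕ) : Word := (List.replicate n v).flatten

end Words

/-!
Words are studied through their prefix counts of the letter `a`. Balance compares increments of this
count, and a word whose prefix count is `⌊(A k + R) / m⌋ + K` for integers `A`, `R`, `K`, `m > 0` is
balanced.

Let `n = |w| + 2`, let `p = |w|_a + 1`, and let `C i` be the number of `a`s among the first `i - 1`
letters of `w`, for `0 < i < n`. Then `b w a` is an upper Christoffel word iff `C i = ⌊p i / n⌋` for
all `i`, and `a w b` is a lower one iff `C i = ⌊(p i - 1) / n⌋` for all `i`. In either case each of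
`aw`, `bw`, `wa`, `wb` has a floor formula with slope `p / n` or `p / n ± 1 / n²`: the perturbation
is too small to be seen inside `w` and changes a single end letter. So `w` is bispecial.

Conversely, let `w` be bispecial. Comparing a factor with a prefix of `aw` and of `bw` shows that
`C (i + j) - C i - C j ∈ {0, 1}`; subtractive Euclid then gives `C i / i < (C j + 1) / j` for all
`i, j` (`mul_lt_of_quasiadditive`). Comparing with suffixes of `wa` and `wb` gives
`C i / i ≤ p / n ≤ (C i + 1) / i` (`slope_bounds`); in the boundary cases all factors of length `i`
(or `n - i`) have the same count, so `C` (or `C + 1`) is additive and linear by Euclid again. By the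
strict inequality the two bounds are never both attained, so `C` is one of the two floor sequences.

For the description by central words, the `i`-th letter of a Christoffel word depends only on whether
`i r mod n < n - r` (`rotationLetter`), where `r` is the number of occurrences of the last letter.
Dividing `n` and `r` by their gcd `g` exhibits the word as a `g`-th power of `x u y`. For `n`, `r`
coprime and `p r ≡ 1` mod `n`, adding `p` to an index adds `1` to `i r mod n`, so the letter changes
only near the indices `0` and `n - 1`, and `u` has the periods `p` and `n - p`. Conversely, if `u` has
coprime periods `p` and `q` with `p + q = n`, then `i ↦ i + p` on `ℤ/n`, with `0` and `-1` removed,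
falls into two arcs on which the letters of `u` are constant, and these arcs are the sets
`i r mod n < n - r` and `i r mod n > n - r`.
-/

namespace Words

/-! ### Prefix counts and balance -/

/-- The number of occurrences of `a` among the first `k` letters of `w`, as an integer so that
increments can be subtracted. For `k > |w|` it is the count in all of `w`. -/
def prefixCount (w : Word) (k : ℕ) : ℤ := ((w.take k).count Letter.a : ℕ)

/-- The indicator of the letter `a`. -/
def indA (x : Letter) : ℤ := if x = Letter.a then 1 else 0

@[simp] theorem indA_a : indA Letter.a = 1 := rfl
@[simp] theorem indA_b : indA Letter.b = 0 := rfl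

theorem indA_injective : Function.Injective indA := by
  intro x y h
  cases x <;> cases y <;> simp_all

@[simp] theorem prefixCount_zero (w : Word) : prefixCount w 0 = 0 := by simp [prefixCount]

theorem prefixCount_cons_succ (x : Letter) (w : Word) (k : ℕ) :
    prefixCount (x :: w) (k + 1) = indA x + prefixCount w k := by
  cases x <;> simp [prefixCount, add_comm]

theorem prefixCount_succ {w : Word} {k : ℕ} (h : k < w.length) :
    prefixCount w (k + 1) = prefixCount w k + indA w[k] := by
  unfold prefixCount
  rw [List.take_succ_eq_append_getElem h, List.count_append]
  cases w[k] <;> simp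

theorem prefixCount_append_singleton {w : Word} {k : ℕ} (x : Letter) (h : k ≤ w.length) :
    prefixCount (w ++ [x]) k = prefixCount w k := by
  simp [prefixCount, List.take_append_of_le_length h]

theorem prefixCount_append_singleton_length (w : Word) (x : Letter) :
    prefixCount (w ++ [x]) (w.length + 1) = prefixCount w w.length + indA x := by
  have h : w.length + 1 = (w ++ [x]).length := by simp
  unfold prefixCount
  rw [h, List.take_length, List.take_length]
  cases x <;> simp

theorem count_take_drop (w : Word) (i l : ℕ) :
    ((((w.drop i).take l).count Letter.a : ℕ) : ℤ) = prefixCount w (i + l) - prefixCount w i := by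
  simp [prefixCount, List.take_add]

/-- Balance in terms of increments of the prefix count over windows of the same length. -/
theorem isSturmian_iff (w : Word) :
    IsSturmian w ↔ ∀ i j l : ℕ, i + l ≤ w.length → j + l ≤ w.length →
      |(prefixCount w (i + l) - prefixCount w i) - (prefixCount w (j + l) - prefixCount w j)|
        ≤ 1 := by
  constructor
  · intro h i j l hi hj
    rw [← count_take_drop, ← count_take_drop]
    refine h _ _ ?_ ?_ ?_
    · exact (List.take_prefix _ _).isInfix.trans (List.drop_suffix _ _).isInfix
    · exact (List.take_prefix _ _).isInfix.trans (List.drop_suffix _ _).isInfix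
    · simp; omega
  · rintro h u v ⟨s, t, rfl⟩ ⟨s', t', hv⟩ hl
    have e1 := count_take_drop (s ++ u ++ t) s.length u.length
    have e2 := count_take_drop (s ++ u ++ t) s'.length u.length
    have e3 : ((s ++ u ++ t).drop s.length).take u.length = u := by simp
    have e4 : ((s ++ u ++ t).drop s'.length).take u.length = v := by
      rw [← hv, hl]; simp
    rw [e3] at e1
    rw [e4] at e2
    rw [e1, e2]
    apply h
    · simp
    · have := congrArg List.length hv
      simp at this ⊢; omega

theorem eq_of_prefixCount_eq {v w : Word} (hl : v.length = w.length)
    (h : ∀ k ≤ v.length, prefixCount v k = prefixCount w k) : v = w := by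
  refine List.ext_getElem hl fun k h1 h2 => indA_injective ?_
  have e1 := prefixCount_succ h1
  have e2 := prefixCount_succ h2
  have e3 := h k h1.le
  have e4 := h (k + 1) h1
  linarith

/-! ### Words with a floor formula are bispecial -/

/-- Increments of `k ↦ ⌊(A k + R) / m⌋` over windows of the same length differ by at most one. -/
theorem isSturmian_of_floor {w : Word} {A R m K : ℤ} (hm : 0 < m)
    (h : ∀ k ≤ w.length, prefixCount w k = (A * k + R) / m + K) : IsSturmian w := by
  rw [isSturmian_iff]
  intro i j l hi hj
  rw [h _ hi, h _ hj, h i (by omega), h j (by omega)]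
  have key : ∀ x : ℤ, m * (x / m) ≤ x ∧ x < m * (x / m) + m := fun x =>
    ⟨Int.mul_ediv_self_le hm.ne', Int.lt_mul_ediv_self_add hm⟩
  obtain ⟨a1, a2⟩ := key (A * (i + l : ℕ) + R)
  obtain ⟨b1, b2⟩ := key (A * (j + l : ℕ) + R)
  obtain ⟨c1, c2⟩ := key (A * i + R)
  obtain ⟨d1, d2⟩ := key (A * j + R)
  set a := (A * (i + l : ℕ) + R) / m
  set b := (A * (j + l : ℕ) + R) / m
  set c := (A * i + R) / m
  set d := (A * j + R) / m
  push_cast at a1 a2 b1 b2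
  have e1 : m * (a - c - (b - d)) < m * 2 := by linarith
  have e2 : m * (-2) < m * (a - c - (b - d)) := by linarith
  have f1 := lt_of_mul_lt_mul_left e1 hm.le
  have f2 := lt_of_mul_lt_mul_left e2 hm.le
  rw [abs_le]
  constructor <;> linarith

/-- A floor formula for the prefix counts of `w`, shifted by one, that also has the right value at
index `0`, which stands for the letter put in front of `w`. -/
theorem isSturmian_cons_of_floor {w : Word} {x : Letter} {A R m : ℤ} (hm : 0 < m)
    (h : ∀ k ≤ w.length, prefixCount w k = (A * (k + 1) + R) / m) (h0 : R / m = -indA x) :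
    IsSturmian ([x] ++ w) := by
  refine isSturmian_of_floor (A := A) (R := R) (K := indA x) hm fun k hk => ?_
  cases k with
  | zero => simp [h0]
  | succ k =>
    rw [List.singleton_append, prefixCount_cons_succ, h k (by simpa using hk)]
    push_cast
    ring

/-- A floor formula for the prefix counts of `w`, shifted by one, that also has the right value at
index `|w| + 2`, which stands for the letter put behind `w`. -/
theorem isSturmian_append_of_floor {w : Word} {x : Letter} {A R m : ℤ} (hm : 0 < m)
    (h : ∀ k ≤ w.length, prefixCount w k = (A * (k + 1) + R) / m)
    (h1 : (A * (w.length + 2) + R) / m = prefixCount w w.length + indA x) :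
    IsSturmian (w ++ [x]) := by
  refine isSturmian_of_floor (A := A) (R := A + R) (K := 0) hm fun k hk => ?_
  rcases Nat.lt_or_ge w.length k with hk' | hk'
  · obtain rfl : k = w.length + 1 := by simp at hk; omega
    rw [prefixCount_append_singleton_length, ← h1, add_zero]
    push_cast
    ring_nf
  · rw [prefixCount_append_singleton _ hk', h k hk']
    ring_nf

/-- A perturbation of `t / n` by less than `1 / n` does not change its integer part. -/
theorem mul_add_ediv_mul_self {n t s : ℤ} (hs : 0 ≤ s) (hsn : s < n) :
    (n * t + s) / (n * n) = t / n := by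
  have hn : 0 < n := by omega
  rw [← Int.ediv_ediv_of_nonneg hn.le, Int.mul_add_ediv_left _ _ hn.ne',
    Int.ediv_eq_zero_of_lt hs hsn, add_zero]

/-- Middles of upper Christoffel words are bispecial. The slope `p / n` accounts for `bw` and `wa`,
the slopes `p / n ± 1 / n ^ 2` for `aw` and `wb`. -/
theorem mem_BS_of_floor {w : Word} {p : ℤ}
    (h : ∀ k ≤ w.length, prefixCount w k = p * (k + 1) / (w.length + 2)) (hp : 0 < p)
    (hpw : p < w.length + 2) : w ∈ BS := by
  set n : ℤ := w.length + 2 with hn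
  have hn0 : 0 < n := by omega
  have hl : prefixCount w w.length = p - 1 := by
    rw [h _ le_rfl]
    have : p * (w.length + 1) = n * (p - 1) + (n - p) := by rw [hn]; ring
    rw [this, Int.mul_add_ediv_left _ _ hn0.ne', Int.ediv_eq_zero_of_lt (by omega) (by omega),
      add_zero]
  have h1 : ∀ k ≤ w.length, prefixCount w k = (p * (k + 1) + 0) / n := by simpa using h
  have h2 : ∀ k ≤ w.length, prefixCount w k = ((n * p + 1) * (k + 1) + (-1)) / (n * n) := by
    intro k hk
    rw [h k hk, ← mul_add_ediv_mul_self (n := n) (s := k) (by omega) (by omega)]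
    congr 1; ring
  have h3 : ∀ k ≤ w.length, prefixCount w k = ((n * p - 1) * (k + 1) + (n - 1)) / (n * n) := by
    intro k hk
    rw [h k hk, ← mul_add_ediv_mul_self (n := n) (s := n - 2 - k) (by omega) (by omega)]
    congr 1; ring
  have hw : IsSturmian w :=
    isSturmian_of_floor (A := p) (R := p) (K := 0) hn0 fun k hk => by
      rw [h k hk, mul_add, mul_one, add_zero]
  refine ⟨⟨hw, ?_, ?_⟩, hw, ?_, ?_⟩
  · refine isSturmian_cons_of_floor (by positivity) h2 ?_
    rw [indA_a, Int.ediv_eq_iff_of_pos (by positivity)]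
    constructor <;> nlinarith
  · exact isSturmian_cons_of_floor hn0 h1 (by simp)
  · refine isSturmian_append_of_floor hn0 h1 ?_
    rw [hl, indA_a, ← hn, add_zero, Int.mul_ediv_cancel _ hn0.ne']; ring
  · refine isSturmian_append_of_floor (by positivity) h3 ?_
    rw [hl, indA_b, ← hn, Int.ediv_eq_iff_of_pos (by positivity)]
    constructor <;> nlinarith

/-- Middles of lower Christoffel words are bispecial. The slope `p / n` accounts for `aw` and `wb`,
the slopes `p / n ± 1 / n ^ 2` for `wa` and `bw`. -/
theorem mem_BS_of_ceil {w : Word} {p : ℤ}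
    (h : ∀ k ≤ w.length, prefixCount w k = (p * (k + 1) - 1) / (w.length + 2)) (hp : 0 < p)
    (hpw : p < w.length + 2) : w ∈ BS := by
  set n : ℤ := w.length + 2 with hn
  have hn0 : 0 < n := by omega
  have hl : prefixCount w w.length = p - 1 := by
    rw [h _ le_rfl]
    have : p * (w.length + 1) - 1 = n * (p - 1) + (n - p - 1) := by rw [hn]; ring
    rw [this, Int.mul_add_ediv_left _ _ hn0.ne', Int.ediv_eq_zero_of_lt (by omega) (by omega),
      add_zero]
  have h1 : ∀ k ≤ w.length, prefixCount w k = (p * (k + 1) + (-1)) / n := by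
    simpa [sub_eq_add_neg] using h
  have h2 : ∀ k ≤ w.length, prefixCount w k = ((n * p - 1) * (k + 1) + 0) / (n * n) := by
    intro k hk
    rw [h k hk, ← mul_add_ediv_mul_self (n := n) (s := n - 1 - k) (by omega) (by omega)]
    congr 1; ring
  have h3 : ∀ k ≤ w.length, prefixCount w k = ((n * p + 1) * (k + 1) + (-n)) / (n * n) := by
    intro k hk
    rw [h k hk, ← mul_add_ediv_mul_self (n := n) (s := k + 1) (by omega) (by omega)]
    congr 1; ring
  have hw : IsSturmian w :=
    isSturmian_of_floor (A := p) (R := p - 1) (K := 0) hn0 fun k hk => by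
      rw [h k hk, add_zero]; congr 1; ring
  refine ⟨⟨hw, ?_, ?_⟩, hw, ?_, ?_⟩
  · refine isSturmian_cons_of_floor hn0 h1 ?_
    rw [indA_a, Int.ediv_eq_iff_of_pos hn0]
    constructor <;> nlinarith
  · exact isSturmian_cons_of_floor (by positivity) h2 (by simp)
  · refine isSturmian_append_of_floor (by positivity) h3 ?_
    rw [hl, indA_a, ← hn, Int.ediv_eq_iff_of_pos (by positivity)]
    constructor <;> nlinarith
  · refine isSturmian_append_of_floor hn0 h1 ?_
    rw [hl, indA_b, ← hn, Int.ediv_eq_iff_of_pos hn0]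
    constructor <;> nlinarith

/-! ### Christoffel words as codings of rotations -/

theorem lower_letter {n p q i : ℕ} (hp : 0 < p) (hq : 0 < q) (hn : p + q = n) :
    ((i + 1) * q) % n > (i * q) % n ↔ (i * q) % n < p := by
  rw [Nat.succ_mul, Nat.add_mod, Nat.mod_eq_of_lt (show q < n by omega)]
  have := Nat.mod_lt (i * q) (show 0 < n by omega)
  rcases Nat.lt_or_ge ((i * q) % n + q) n with h | h
  · rw [Nat.mod_eq_of_lt h]; omega
  · rw [Nat.mod_eq_sub_mod h, Nat.mod_eq_of_lt (by omega)]; omega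

theorem upper_letter {n p q i : ℕ} (hp : 0 < p) (hq : 0 < q) (hn : p + q = n) :
    ((i + 1) * p) % n < (i * p) % n ↔ ¬ (i * p) % n < q := by
  rw [Nat.succ_mul, Nat.add_mod, Nat.mod_eq_of_lt (show p < n by omega)]
  have := Nat.mod_lt (i * p) (show 0 < n by omega)
  rcases Nat.lt_or_ge ((i * p) % n + p) n with h | h
  · rw [Nat.mod_eq_of_lt h]; omega
  · rw [Nat.mod_eq_sub_mod h, Nat.mod_eq_of_lt (by omega)]; omega

/-- The coding of the rotation `i ↦ i r mod n` by `x` on the residues below `n - r` and by `y` on the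
other ones. For `0 < r < n` the first `n` letters form the lower Christoffel word `w_{n-r,r}` if
`(x, y) = (a, b)`, and the upper one `w'_{r,n-r}` if `(x, y) = (b, a)`. -/
def rotationLetter (n r : ℕ) (x y : Letter) (i : ℕ) : Letter :=
  if (i * r) % n < n - r then x else y

theorem isChristoffel_iff_rotation {w : Word} :
    IsChristoffel w ↔ ∃ (n r : ℕ) (x y : Letter), 0 < r ∧ r < n ∧ x ≠ y ∧
      w = (List.range n).map (rotationLetter n r x y) := by
  constructor
  · rintro ⟨p, q, hp, hq, rfl | rfl⟩
    · refine ⟨p + q, q, .a, .b, hq, by omega, by decide, ?_⟩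
      refine List.map_congr_left fun i _ => ?_
      simp only [rotationLetter, lower_letter hp hq rfl, Nat.add_sub_cancel]
    · refine ⟨p + q, p, .b, .a, hp, by omega, by decide, ?_⟩
      refine List.map_congr_left fun i _ => ?_
      simp only [rotationLetter, upper_letter hp hq rfl, Nat.add_sub_cancel_left, ite_not]
  · rintro ⟨n, r, x, y, hr, hrn, hxy, rfl⟩
    obtain ⟨s, rfl⟩ : ∃ s, n = s + r := ⟨n - r, by omega⟩
    have hs : 0 < s := by omega
    cases x <;> cases y <;> try exact absurd rfl hxy
    · refine ⟨s, r, hs, hr, Or.inl (List.map_congr_left fun i _ => ?_)⟩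
      simp only [rotationLetter, lower_letter hs hr rfl, Nat.add_sub_cancel]
    · refine ⟨r, s, hr, hs, Or.inr ?_⟩
      unfold upperChristoffel
      rw [add_comm r s]
      refine List.map_congr_left fun i _ => ?_
      simp only [rotationLetter, upper_letter hr hs (add_comm r s), Nat.add_sub_cancel, ite_not]

theorem prefixCount_range_map (f : ℕ → Letter) (n : ℕ) (g : ℕ → ℤ) (h0 : g 0 = 0)
    (h : ∀ k < n, g (k + 1) = g k + indA (f k)) :
    ∀ k ≤ n, prefixCount ((List.range n).map f) k = g k := by
  intro k
  induction k with
  | zero => simp [h0]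
  | succ k ih =>
    intro hk
    rw [prefixCount_succ (by simpa using hk), ih (by omega), h k (by omega)]
    simp

/-- The integer part of `t / n` jumps exactly when adding `r` to the residue of `t` wraps around. -/
theorem ediv_step {n r t : ℕ} (hr : r < n) :
    ((t + r : ℕ) : ℤ) / n = (t : ℤ) / n + if t % n < n - r then 0 else 1 := by
  have hn : (0 : ℤ) < n := by omega
  have hm : (t : ℤ) % n + n * (t / n) = t := Int.emod_add_mul_ediv _ _
  have h0 := Int.emod_nonneg (t : ℤ) hn.ne'
  have hlt := Int.emod_lt_of_pos (t : ℤ) hn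
  have hc : t % n < n - r ↔ (t : ℤ) % n < n - r := by omega
  rw [Int.ediv_eq_iff_of_pos hn, if_congr hc rfl rfl]
  push_cast
  split_ifs <;> (constructor <;> linarith)

theorem prefixCount_upper {n r : ℕ} (hr : r < n) : ∀ k ≤ n,
    prefixCount ((List.range n).map (rotationLetter n r .b .a)) k = (r : ℤ) * k / n := by
  refine prefixCount_range_map _ _ (fun k => (r : ℤ) * k / n) (by simp) fun k _ => ?_
  have := ediv_step (t := k * r) hr
  push_cast at this ⊢
  rw [show (r : ℤ) * (k + 1) = k * r + r by ring, this, mul_comm (r : ℤ) k]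
  congr 1
  unfold rotationLetter
  split_ifs <;> simp

/-- The complementary count: `k - ⌊k r / n⌋ = ⌈(n - r) k / n⌉`. -/
theorem sub_ediv {n k r : ℤ} (hn : 0 < n) :
    k - k * r / n = ((n - r) * k - 1) / n + 1 := by
  have h1 := Int.mul_ediv_self_le (x := k * r) hn.ne'
  have h2 := Int.lt_mul_ediv_self_add (x := k * r) hn
  have : ((n - r) * k - 1) / n = k - k * r / n - 1 := by
    rw [Int.ediv_eq_iff_of_pos hn]
    constructor <;> nlinarith
  omega

theorem prefixCount_lower {n r : ℕ} (hr : r < n) : ∀ k ≤ n,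
    prefixCount ((List.range n).map (rotationLetter n r .a .b)) k =
      (((n : ℤ) - r) * k - 1) / n + 1 := by
  have hn : (0 : ℤ) < n := by omega
  refine prefixCount_range_map _ _ (fun k => (((n : ℤ) - r) * k - 1) / n + 1) ?_ fun k _ => ?_
  · simp only [← sub_ediv hn]
    simp
  · have := ediv_step (t := k * r) hr
    simp only [← sub_ediv hn]
    push_cast at this ⊢
    rw [show ((k : ℤ) + 1) * r = k * r + r by ring, this]
    unfold rotationLetter
    split_ifs
    · simp; ring
    · simp

theorem length_of_range_map {f : ℕ → Letter} {n : ℕ} {x y : Letter} {w : Word}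
    (h : [x] ++ w ++ [y] = (List.range n).map f) : n = w.length + 2 := by
  have := congrArg List.length h
  simp at this; omega

theorem prefixCount_middle {x y : Letter} {w : Word} {k : ℕ} (hk : k ≤ w.length) :
    prefixCount ([x] ++ w ++ [y]) (k + 1) = indA x + prefixCount w k := by
  rw [prefixCount_append_singleton _ (by simpa using hk), List.singleton_append,
    prefixCount_cons_succ]

theorem mem_BS_of_isChristoffel {w : Word} {x y : Letter}
    (h : IsChristoffel ([x] ++ w ++ [y])) : w ∈ BS := by
  obtain ⟨n, r, x', y', hr, hrn, hxy, e⟩ := isChristoffel_iff_rotation.1 h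
  obtain rfl := length_of_range_map e
  have hx : x = x' := by
    have := congrArg (fun l => l[0]?) e
    have h0 : r < w.length + 1 + 1 := hrn
    simpa [rotationLetter, h0] using this
  subst hx
  cases x <;> cases y' <;> try exact absurd rfl hxy
  · refine mem_BS_of_ceil (p := w.length + 2 - r) (fun k hk => ?_) (by omega) (by omega)
    have h1 := prefixCount_lower hrn (k + 1) (by omega)
    rw [← e, prefixCount_middle hk] at h1
    push_cast at h1
    rw [indA_a] at h1
    linarith
  · refine mem_BS_of_floor (p := r) (fun k hk => ?_) (by omega) (by omega)
    have h1 := prefixCount_upper hrn (k + 1) (by omega)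
    rw [← e, prefixCount_middle hk] at h1
    push_cast at h1
    rw [indA_b] at h1
    linarith

/-! ### Bispecial words are middles of Christoffel words -/

/-- All the slopes `C i / i` lie strictly below all the `(C j + 1) / j`, by subtractive Euclid on
`(i, j)`. -/
theorem mul_lt_of_quasiadditive {C : ℕ → ℤ} {n : ℕ}
    (h : ∀ i j, 0 < i → 0 < j → i + j < n → C i + C j ≤ C (i + j) ∧ C (i + j) ≤ C i + C j + 1)
    (i j : ℕ) (hi : 0 < i) (hj : 0 < j) (hin : i < n) (hjn : j < n) :
    (j : ℤ) * C i < i * (C j + 1) := by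
  rcases lt_trichotomy i j with hij | rfl | hij
  · obtain ⟨d, rfl⟩ := Nat.exists_eq_add_of_lt hij
    have ih := mul_lt_of_quasiadditive h i (d + 1) hi (by omega) hin (by omega)
    have h1 := (h i (d + 1) hi (by omega) (by omega)).1
    have h2 := mul_le_mul_of_nonneg_left h1 (show (0 : ℤ) ≤ i by omega)
    rw [add_assoc]
    push_cast at ih ⊢
    linarith
  · nlinarith
  · obtain ⟨d, rfl⟩ := Nat.exists_eq_add_of_lt hij
    have ih := mul_lt_of_quasiadditive h (d + 1) j (by omega) hj (by omega) hjn
    have h1 := (h j (d + 1) hj (by omega) (by omega)).2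
    have h2 := mul_le_mul_of_nonneg_left h1 (show (0 : ℤ) ≤ j by omega)
    rw [add_assoc]
    push_cast at ih ⊢
    linarith
termination_by i + j

/-- A sequence on `0 < k < i + j` that is additive under the shifts by `i` and by `j` has
`C i / i = C j / j`, by subtractive Euclid on `(i, j)`. -/
theorem mul_eq_of_additive {C : ℕ → ℤ} (i j : ℕ) (hi : 0 < i) (hj : 0 < j)
    (h1 : ∀ k, 0 < k → k < j → C (k + i) = C k + C i)
    (h2 : ∀ k, 0 < k → k < i → C (k + j) = C k + C j) : (j : ℤ) * C i = i * C j := by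
  rcases lt_trichotomy i j with hij | rfl | hij
  · obtain ⟨d, hd, rfl⟩ : ∃ d, 0 < d ∧ j = d + i := ⟨j - i, by omega, by omega⟩
    have hC := h1 d hd (by omega)
    have ih := mul_eq_of_additive i d hi hd (fun k hk hkd => h1 k hk (by omega)) fun k hk hki => by
      have e1 := h2 k hk hki
      have e2 := h1 (k + d) (by omega) (by omega)
      rw [← add_assoc] at e1
      linarith
    rw [hC]
    push_cast
    linarith
  · rfl
  · obtain ⟨d, hd, rfl⟩ : ∃ d, 0 < d ∧ i = d + j := ⟨i - j, by omega, by omega⟩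
    have hC := h2 d hd (by omega)
    have ih := mul_eq_of_additive d j hd hj (fun k hk hkj => by
      have e1 := h1 k hk hkj
      have e2 := h2 (k + d) (by omega) (by omega)
      rw [← add_assoc] at e1
      linarith) fun k hk hkd => h2 k hk (by omega)
    rw [hC]
    push_cast
    linarith
termination_by i + j

/-- The slope `p / n` separates the `C i / i` from the `(C i + 1) / i`, weakly. The hypothesis `h'`
bounds the count in a factor of length `i` by the counts in the suffixes of length `i` of `wa` and
`wb`. -/
theorem slope_bounds {C : ℕ → ℤ} {n : ℕ} {p : ℤ} (hC1 : C 1 = 0) (hCn : C (n - 1) = p - 1)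
    (h : ∀ i j, 0 < i → 0 < j → i + j < n → C i + C j ≤ C (i + j) ∧ C (i + j) ≤ C i + C j + 1)
    (h' : ∀ i j k, 0 < i → 0 < j → 0 < k → i + j = n → k + i < n →
      p - 1 ≤ C (k + i) - C k + C j ∧ C (k + i) - C k + C j ≤ p)
    (i : ℕ) (hi : 0 < i) (hin : i < n) : n * C i ≤ p * i ∧ p * i ≤ n * (C i + 1) := by
  obtain ⟨j, hj, rfl⟩ : ∃ j, 0 < j ∧ n = i + j := ⟨n - i, by omega, by omega⟩
  have lt1 := mul_lt_of_quasiadditive h i j hi hj (by omega) (by omega)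
  have lt2 := mul_lt_of_quasiadditive h j i hj hi (by omega) (by omega)
  have hi0 : (0 : ℤ) ≤ i := by omega
  have hsum : p - 2 ≤ C i + C j ∧ C i + C j ≤ p := by
    rcases Nat.eq_or_lt_of_le (show 1 ≤ j from hj) with rfl | hj1
    · rw [Nat.add_sub_cancel] at hCn
      omega
    · have a1 := h' i j 1 hi hj one_pos rfl (by omega)
      have a2 := h 1 i one_pos hi (by omega)
      omega
  push_cast
  constructor
  · rcases le_or_gt (C i + C j) (p - 1) with hle | hgt
    · nlinarith [mul_le_mul_of_nonneg_left hle hi0]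
    -- all the factors of length `i`, and those of length `j`, have the same count
    · have hp : C i + C j = p := by omega
      have key := mul_eq_of_additive (C := C) i j hi hj
        (fun k hk hkj => by
          have a1 := h' i j k hi hj hk rfl (by omega)
          have a2 := h k i hk hi (by omega)
          omega)
        (fun k hk hki => by
          have a1 := h' j i k hj hi hk (by omega) (by omega)
          have a2 := h k j hk hj (by omega)
          omega)
      rw [← hp]
      linarith
  · rcases le_or_gt (p - 1) (C i + C j) with hle | hgt
    · nlinarith [mul_le_mul_of_nonneg_left hle hi0]
    -- the same for the counts increased by one
    · have hp : C i + C j = p - 2 := by omega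
      have key := mul_eq_of_additive (C := fun k => C k + 1) i j hi hj
        (fun k hk hkj => by
          have a1 := h' i j k hi hj hk rfl (by omega)
          have a2 := h k i hk hi (by omega)
          omega)
        (fun k hk hki => by
          have a1 := h' j i k hj hi hk (by omega) (by omega)
          have a2 := h k j hk hj (by omega)
          omega)
      rw [show p = C i + C j + 2 by omega]
      linarith

/-- The two bounds of `slope_bounds` cannot both be attained, which makes `C i` either always the
floor of `p i / n` or always its ceiling minus one. -/
theorem floor_or_ceil {C : ℕ → ℤ} {n : ℕ} {p : ℤ} (hC1 : C 1 = 0) (hCn : C (n - 1) = p - 1)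
    (h : ∀ i j, 0 < i → 0 < j → i + j < n → C i + C j ≤ C (i + j) ∧ C (i + j) ≤ C i + C j + 1)
    (h' : ∀ i j k, 0 < i → 0 < j → 0 < k → i + j = n → k + i < n →
      p - 1 ≤ C (k + i) - C k + C j ∧ C (k + i) - C k + C j ≤ p) :
    (∀ i, 0 < i → i < n → C i = p * i / n) ∨
      ∀ i, 0 < i → i < n → C i = (p * i - 1) / n := by
  have hb := slope_bounds hC1 hCn h h'
  by_cases hex : ∃ i, 0 < i ∧ i < n ∧ n * C i = p * i
  · obtain ⟨i, hi, hin, e⟩ := hex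
    have hn : (0 : ℤ) < n := by omega
    left
    intro j hj hjn
    obtain ⟨b1, b2⟩ := hb j hj hjn
    have hlt := mul_lt_of_quasiadditive h i j hi hj hin hjn
    have hne : p * j ≠ n * (C j + 1) := by
      intro e'
      have := mul_lt_mul_of_pos_left hlt hn
      have e1 : (n : ℤ) * (j * C i) = p * i * j := by rw [← e]; ring
      have e2 : (n : ℤ) * (i * (C j + 1)) = p * j * i := by rw [e']; ring
      rw [e1, e2] at this
      linarith
    have := lt_of_le_of_ne b2 hne
    symm
    rw [Int.ediv_eq_iff_of_pos hn]
    constructor <;> linarith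
  · right
    intro j hj hjn
    have hn : (0 : ℤ) < n := by omega
    obtain ⟨b1, b2⟩ := hb j hj hjn
    have := lt_of_le_of_ne b1 fun e => hex ⟨j, hj, hjn, e⟩
    symm
    rw [Int.ediv_eq_iff_of_pos hn]
    constructor <;> linarith

theorem exists_isChristoffel_of_mem_BS {w : Word} (hw : w ∈ BS) :
    ∃ x y, IsChristoffel ([x] ++ w ++ [y]) := by
  obtain ⟨⟨-, ha, hb⟩, -, ha', hb'⟩ := hw
  rw [isSturmian_iff] at ha hb ha' hb'
  -- `C i` counts the `a`s among the first `i - 1` letters; its value at `0` is never used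
  set C : ℕ → ℤ := fun i => prefixCount w (i - 1) with hCdef
  set n := w.length + 2 with hn
  set p : ℕ := w.count Letter.a + 1 with hp
  have hpn : p < n := by
    have := List.count_le_length (a := Letter.a) (l := w); omega
  have hCs : ∀ k, prefixCount w k = C (k + 1) := fun k => by simp [hCdef]
  have hCn : C (n - 1) = (p : ℤ) - 1 := by simp [hCdef, hn, hp, prefixCount]
  have h : ∀ i j, 0 < i → 0 < j → i + j < n →
      C i + C j ≤ C (i + j) ∧ C (i + j) ≤ C i + C j + 1 := by
    intro i j hi hj hij
    obtain ⟨i, rfl⟩ : ∃ i', i = i' + 1 := ⟨i - 1, by omega⟩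
    obtain ⟨j, rfl⟩ : ∃ j', j = j' + 1 := ⟨j - 1, by omega⟩
    have a1 := ha (i + 1) 0 (j + 1) (by simp; omega) (by simp; omega)
    have a2 := hb (i + 1) 0 (j + 1) (by simp; omega) (by simp; omega)
    rw [show i + 1 + (j + 1) = (i + j + 1) + 1 by ring] at a1 a2 ⊢
    simp only [List.singleton_append, zero_add, prefixCount_cons_succ, prefixCount_zero, indA_a,
      indA_b, hCs] at a1 a2
    rw [abs_le] at a1 a2
    omega
  have h' : ∀ i j k, 0 < i → 0 < j → 0 < k → i + j = n → k + i < n →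
      p - 1 ≤ C (k + i) - C k + C j ∧ C (k + i) - C k + C j ≤ p := by
    intro i j k hi hj hk hij hki
    obtain ⟨j, rfl⟩ : ∃ j', j = j' + 1 := ⟨j - 1, by omega⟩
    obtain ⟨k, rfl⟩ : ∃ k', k = k' + 1 := ⟨k - 1, by omega⟩
    have a1 := ha' k j i (by simp; omega) (by simp; omega)
    have a2 := hb' k j i (by simp; omega) (by simp; omega)
    have hl : j + i = w.length + 1 := by omega
    rw [hl, prefixCount_append_singleton_length, prefixCount_append_singleton _ (by omega),
      prefixCount_append_singleton _ (by omega), prefixCount_append_singleton _ (by omega)] at a1 a2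
    rw [hCs w.length, show w.length + 1 = n - 1 by omega, hCn] at a1 a2
    simp only [indA_a, indA_b, hCs] at a1 a2
    rw [show k + i + 1 = k + 1 + i by ring, abs_le] at a1 a2
    omega
  rcases floor_or_ceil (C := C) (n := n) (p := p) (by simp [hCdef]) hCn h h' with H | H
  · refine ⟨.b, .a, isChristoffel_iff_rotation.2
      ⟨n, p, .b, .a, by omega, hpn, by decide, eq_of_prefixCount_eq (by simp [hn]) ?_⟩⟩
    intro k hk
    replace hk : k ≤ n := by simp at hk; omega
    rw [prefixCount_upper hpn k hk]
    rcases Nat.eq_zero_or_pos k with rfl | hk0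
    · simp
    obtain ⟨k, rfl⟩ : ∃ k', k = k' + 1 := ⟨k - 1, by omega⟩
    rcases Nat.lt_or_ge w.length k with hlt | hle
    · obtain rfl : k = w.length + 1 := by omega
      have e := prefixCount_append_singleton_length ([Letter.b] ++ w) .a
      rw [show ([Letter.b] ++ w).length = w.length + 1 by simp, List.singleton_append,
        prefixCount_cons_succ, hCs, show w.length + 1 = n - 1 by omega, hCn,
        show n - 1 + 1 = n by omega] at e
      rw [show w.length + 1 + 1 = n by omega, List.singleton_append, e,
        Int.mul_ediv_cancel _ (by omega)]
      simp
    · rw [prefixCount_middle hle, hCs, H _ (by omega) (by omega)]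
      simp
  · refine ⟨.a, .b, isChristoffel_iff_rotation.2
      ⟨n, n - p, .a, .b, by omega, by omega, by decide, eq_of_prefixCount_eq (by simp [hn]) ?_⟩⟩
    intro k hk
    replace hk : k ≤ n := by simp at hk; omega
    rw [prefixCount_lower (by omega) k hk, show (n : ℤ) - (n - p : ℕ) = p by omega]
    rcases Nat.eq_zero_or_pos k with rfl | hk0
    · have : (-1 : ℤ) / n = -1 := by
        rw [Int.ediv_eq_iff_of_pos (by omega)]
        constructor <;> omega
      simp [this]
    obtain ⟨k, rfl⟩ : ∃ k', k = k' + 1 := ⟨k - 1, by omega⟩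
    rcases Nat.lt_or_ge w.length k with hlt | hle
    · obtain rfl : k = w.length + 1 := by omega
      have e := prefixCount_append_singleton_length ([Letter.a] ++ w) .b
      rw [show ([Letter.a] ++ w).length = w.length + 1 by simp, List.singleton_append,
        prefixCount_cons_succ, hCs, show w.length + 1 = n - 1 by omega, hCn,
        show n - 1 + 1 = n by omega] at e
      have e2 : ((p : ℤ) * n - 1) / n = p - 1 := by
        rw [Int.ediv_eq_iff_of_pos (by omega)]
        constructor <;> nlinarith
      rw [show w.length + 1 + 1 = n by omega, List.singleton_append, e, e2]
      simp
    · rw [prefixCount_middle hle, hCs, H _ (by omega) (by omega), indA_a, add_comm]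

/-! ### Powers and central words -/

theorem range_map_add_two (f : ℕ → Letter) (m : ℕ) :
    (List.range (m + 2)).map f =
      [f 0] ++ (List.range m).map (fun i => f (i + 1)) ++ [f (m + 1)] := by
  rw [List.range_succ, List.range_succ_eq_map]
  simp [Function.comp_def]

/-- The first `g n` terms of an `n`-periodic sequence form the `g`-th power of its first `n` terms. -/
theorem range_map_periodic {f : ℕ → Letter} {n : ℕ} (hf : ∀ i, f (n + i) = f i) (g : ℕ) :
    (List.range (g * n)).map f = wordPow ((List.range n).map f) g := by
  induction g with
  | zero => simp [wordPow]
  | succ g ih =>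
    rw [Nat.succ_mul, add_comm, List.range_add, List.map_append, List.map_map]
    simp only [Function.comp_def, hf, ih]
    simp [wordPow, List.replicate_succ]

/-- The words `(u y x) ^ n u` are the middles of the powers of `x u y`. -/
theorem conj_wordPow (x y : Letter) (u : Word) (n : ℕ) :
    [x] ++ (wordPow (u ++ [y, x]) n ++ u) ++ [y] = wordPow ([x] ++ u ++ [y]) (n + 1) := by
  induction n with
  | zero => simp [wordPow]
  | succ n ih =>
    have h : wordPow ([x] ++ u ++ [y]) (n + 2) =
      ([x] ++ u ++ [y]) ++ wordPow ([x] ++ u ++ [y]) (n + 1) := by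
        simp [wordPow, List.replicate_succ]
    rw [h, ← ih]
    simp [wordPow, List.replicate_succ]

theorem rotationLetter_mul {g : ℕ} (hg : 0 < g) (n r : ℕ) (x y : Letter) (i : ℕ) :
    rotationLetter (g * n) (g * r) x y i = rotationLetter n r x y i := by
  unfold rotationLetter
  rw [Nat.mul_left_comm, Nat.mul_mod_mul_left, ← Nat.mul_sub]
  exact if_congr (Nat.mul_lt_mul_left hg) rfl rfl

theorem rotationLetter_add_self (n r : ℕ) (x y : Letter) (i : ℕ) :
    rotationLetter n r x y (n + i) = rotationLetter n r x y i := by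
  unfold rotationLetter
  rw [Nat.add_mul, Nat.mul_add_mod]

theorem pred_mul_mod {n r : ℕ} (hr : 0 < r) (hrn : r < n) : ((n - 1) * r) % n = n - r := by
  obtain ⟨m, rfl⟩ : ∃ m, n = m + 1 := ⟨n - 1, by omega⟩
  obtain ⟨s, rfl⟩ : ∃ s, r = s + 1 := ⟨r - 1, by omega⟩
  rw [show (m + 1 - 1) * (s + 1) = (m + 1) * s + (m + 1 - (s + 1)) by
    rw [Nat.add_sub_cancel, Nat.add_sub_add_right]
    zify [show s ≤ m by omega]
    ring, Nat.mul_add_mod, Nat.mod_eq_of_lt (by omega)]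

/-- An interior index avoids `0` and `-1` mod `n`, the two indices where the coding changes. -/
theorem mul_mod_ne {n r i : ℕ} (h : Nat.Coprime n r) (hrn : r < n) (hi : 0 < i)
    (hin : i < n - 1) : (i * r) % n ≠ 0 ∧ (i * r) % n ≠ n - r := by
  constructor
  · intro e
    exact Nat.not_dvd_of_pos_of_lt hi (by omega)
      (h.dvd_of_dvd_mul_right (Nat.dvd_of_mod_eq_zero e))
  · intro e
    have : n ∣ (i + 1) * r := by
      refine Nat.dvd_of_mod_eq_zero ?_
      rw [Nat.succ_mul, Nat.add_mod, e, Nat.mod_eq_of_lt hrn, Nat.sub_add_cancel hrn.le,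
        Nat.mod_self]
    exact Nat.not_dvd_of_pos_of_lt (Nat.succ_pos i) (by omega) (h.dvd_of_dvd_mul_right this)

/-- For `p` inverse to `r` mod `n`, adding `p` to the index moves the rotation by `1`. -/
theorem mul_mod_succ {n r p i : ℕ} (hn : 0 < n) (hp : (p * r) % n = 1) (h0 : ((i + p) * r) % n ≠ 0) :
    ((i + p) * r) % n = (i * r) % n + 1 := by
  rw [Nat.add_mul, Nat.add_mod, hp] at h0 ⊢
  have := Nat.mod_lt (i * r) hn
  rcases Nat.lt_or_ge ((i * r) % n + 1) n with h | h
  · exact Nat.mod_eq_of_lt h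
  · rw [show (i * r) % n + 1 = n by omega, Nat.mod_self] at h0
    exact absurd rfl h0

theorem rotationLetter_add {n r p i : ℕ} (x y : Letter) (hn : 0 < n) (hp : (p * r) % n = 1)
    (h0 : ((i + p) * r) % n ≠ 0) (h1 : ((i + p) * r) % n ≠ n - r) :
    rotationLetter n r x y (i + p) = rotationLetter n r x y i := by
  have h := mul_mod_succ hn hp h0
  unfold rotationLetter
  exact if_congr (by omega) rfl rfl

/-- The middle of a primitive Christoffel word of length `m + 2` is central, with periods `p` and
`m + 2 - p` for `p` inverse to `r`. -/
theorem isCentral_rotation {m r : ℕ} (x y : Letter) (h : Nat.Coprime (m + 2) r)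
    (hr : r < m + 2) :
    IsCentral ((List.range m).map fun i => rotationLetter (m + 2) r x y (i + 1)) := by
  obtain ⟨p, hpn, hp⟩ := Nat.exists_mul_mod_eq_one_of_coprime h.symm (by omega)
  rw [mul_comm] at hp
  set n := m + 2 with hn
  have hp0 : 0 < p := Nat.pos_of_ne_zero fun e => by simp [e] at hp
  have hcop : Nat.Coprime p n := Nat.coprime_of_mul_modEq_one r
    (by rw [Nat.ModEq, hp, Nat.mod_eq_of_lt (by omega)])
  obtain ⟨q, hq⟩ : ∃ q, n = p + q := ⟨n - p, by omega⟩
  refine ⟨p, q, ⟨hp0, ?_⟩, ⟨by omega, ?_⟩, ?_, by simp; omega⟩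
  · rw [List.hasPeriod_iff_getElem?]
    intro i hi
    simp only [List.length_map, List.length_range] at hi
    obtain ⟨h0, h1⟩ := mul_mod_ne h hr (i := i + 1 + p) (by omega) (by omega)
    have := rotationLetter_add x y (by omega) hp h0 h1
    rw [List.getElem?_eq_getElem (by simp; omega), List.getElem?_eq_getElem (by simp; omega)]
    simp only [List.getElem_map, List.getElem_range]
    rw [← this, add_right_comm]
  · rw [List.hasPeriod_iff_getElem?]
    intro i hi
    simp only [List.length_map, List.length_range] at hi
    obtain ⟨h0, h1⟩ := mul_mod_ne h hr (i := i + 1) (by omega) (by omega)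
    -- going forward by `q` is going back by `p` mod `n`
    have e : i + q + 1 + p = n + (i + 1) := by omega
    have := rotationLetter_add (i := i + q + 1) x y (by omega) hp
      (by rwa [e, Nat.add_mul, Nat.mul_add_mod]) (by rwa [e, Nat.add_mul, Nat.mul_add_mod])
    rw [e, rotationLetter_add_self] at this
    rw [List.getElem?_eq_getElem (by simp; omega), List.getElem?_eq_getElem (by simp; omega)]
    simp only [List.getElem_map, List.getElem_range]
    exact congrArg some this
  · rw [hq] at hcop
    simpa using hcop

/-- Dividing out the gcd of `n` and `r` turns a Christoffel word into a power of a primitive one. -/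
theorem exists_central_of_isChristoffel {w : Word} {x y : Letter}
    (h : IsChristoffel ([x] ++ w ++ [y])) :
    ∃ (u : Word) (n : ℕ) (x y : Letter), IsCentral u ∧ x ≠ y ∧
      w = wordPow (u ++ [y, x]) n ++ u := by
  obtain ⟨n, r, x', y', hr, hrn, hxy, e⟩ := isChristoffel_iff_rotation.1 h
  obtain ⟨g, n', r', hg, hcop, rfl, rfl⟩ := Nat.exists_coprime' (Nat.gcd_pos_of_pos_right n hr)
  rw [mul_comm n', mul_comm r'] at *
  have hr' : 0 < r' := Nat.pos_of_mul_pos_left hr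
  have hrn' : r' < n' := lt_of_mul_lt_mul_left hrn (Nat.zero_le g)
  obtain ⟨m, rfl⟩ : ∃ m, n' = m + 2 := ⟨n' - 2, by omega⟩
  obtain ⟨k, rfl⟩ : ∃ k, g = k + 1 := ⟨g - 1, by omega⟩
  refine ⟨_, k, x', y', isCentral_rotation x' y' hcop hrn', hxy, ?_⟩
  rw [show rotationLetter ((k + 1) * (m + 2)) ((k + 1) * r') x' y' =
    rotationLetter (m + 2) r' x' y' from funext (rotationLetter_mul (Nat.succ_pos k) _ _ _ _),
    range_map_periodic (rotationLetter_add_self _ _ _ _), range_map_add_two,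
    show rotationLetter (m + 2) r' x' y' 0 = x' by simp [rotationLetter, hrn'],
    show rotationLetter (m + 2) r' x' y' (m + 1) = y' by
      have := pred_mul_mod hr' hrn'
      rw [show m + 2 - 1 = m + 1 by omega] at this
      simp [rotationLetter, this], ← conj_wordPow] at e
  simp only [List.cons_append, List.cons.injEq] at e
  exact (List.append_inj' e.2 rfl).1

/-- The letters at the indices `p, 2 p, 3 p, …` mod `n` agree until the index `-1` is reached: each
step is a shift by `p` or by `-q`. The number of the step is `i r mod n`. -/
theorem eq_of_arc {U : ℕ → Letter} {n p q r : ℕ} (hpq : p + q = n) (hp : (p * r) % n = 1)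
    (hcop : Nat.Coprime n r) (hr : 0 < r) (hrn : r < n)
    (hUp : ∀ i, 0 < i → i + p < n - 1 → U i = U (i + p))
    (hUq : ∀ i, 0 < i → i + q < n - 1 → U i = U (i + q)) (i : ℕ) (hi : 0 < i) (hin : i < n - 1)
    (hlt : (i * r) % n < n - r) : U i = U p := by
  induction ht : (i * r) % n using Nat.strong_induction_on generalizing i with
  | _ t ih =>
    obtain ⟨h0, -⟩ := mul_mod_ne hcop hrn hi hin
    rcases lt_trichotomy i p with hip | rfl | hip
    · have e : i + q + p = n + i := by omega
      have e' : ((i + q + p) * r) % n = (i * r) % n := by rw [e, Nat.add_mul, Nat.mul_add_mod]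
      have hs := mul_mod_succ (i := i + q) (by omega) hp (by rwa [e'])
      rw [e'] at hs
      have hne : i + q ≠ n - 1 := fun h => by
        rw [h, pred_mul_mod hr hrn] at hs
        omega
      rw [hUq i hi (by omega)]
      exact ih _ (by omega) _ (by omega) (by omega) (by omega) rfl
    · rfl
    · obtain ⟨j, rfl⟩ : ∃ j, i = j + p := ⟨i - p, by omega⟩
      have hs := mul_mod_succ (by omega) hp h0
      rw [← hUp j (by omega) hin]
      exact ih _ (by omega) j (by omega) (by omega) (by omega) rfl

theorem mul_sub_mod {n r i : ℕ} (hrn : r < n) (h0 : (i * r) % n ≠ 0) :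
    (i * (n - r)) % n = n - (i * r) % n := by
  have hlt := Nat.mod_lt (i * r) (show 0 < n by omega)
  have h : i * (n - r) + (n - (n - (i * r) % n)) ≡ (n - (i * r) % n) + (n - (n - (i * r) % n))
      [MOD n] := by
    rw [show n - (n - (i * r) % n) = (i * r) % n by omega,
      show n - (i * r) % n + (i * r) % n = n by omega]
    refine ((Nat.mod_modEq (i * r) n).add_left _).trans ?_
    rw [← Nat.mul_add, Nat.sub_add_cancel hrn.le, Nat.ModEq, Nat.mul_mod_left, Nat.mod_self]
  have := Nat.ModEq.add_right_cancel' _ h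
  rwa [Nat.ModEq, Nat.mod_eq_of_lt (show n - (i * r) % n < n by omega)] at this

/-- Under the periods `p` and `q` the arc of `eq_of_arc` for `(p, r)` and the one for `(q, n - r)`
cover all interior indices. -/
theorem eq_rotationLetter_of_periods {U : ℕ → Letter} {n p q r : ℕ} (hpq : p + q = n)
    (hp : (p * r) % n = 1) (hq : (q * (n - r)) % n = 1) (hcop : Nat.Coprime n r) (hr : 0 < r)
    (hrn : r < n) (hUp : ∀ i, 0 < i → i + p < n - 1 → U i = U (i + p))
    (hUq : ∀ i, 0 < i → i + q < n - 1 → U i = U (i + q)) (i : ℕ) (hi : 0 < i)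
    (hin : i < n - 1) : U i = rotationLetter n r (U p) (U q) i := by
  unfold rotationLetter
  obtain ⟨h0, h1⟩ := mul_mod_ne hcop hrn hi hin
  split_ifs with h
  · exact eq_of_arc hpq hp hcop hr hrn hUp hUq i hi hin h
  · refine eq_of_arc (r := n - r) (by omega) hq ((Nat.coprime_self_sub_right hrn.le).2 hcop)
      (by omega) (by omega) hUq hUp i hi hin ?_
    rw [mul_sub_mod hrn h0]
    omega

/-- If the letters of `u` follow the coding with parameters `|u| + 2` and `r`, then so does `x u y`,
and the powers of `x u y` follow the coding with both parameters multiplied. -/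
theorem isChristoffel_of_letters {u : Word} {U : ℕ → Letter} {r : ℕ} {x y : Letter}
    (hu : u = (List.range u.length).map fun i => U (i + 1)) (hxy : x ≠ y) (hr : 0 < r)
    (hrn : r < u.length + 2)
    (h : ∀ i, 0 < i → i < u.length + 1 → U i = rotationLetter (u.length + 2) r x y i) (k : ℕ) :
    IsChristoffel (wordPow ([x] ++ u ++ [y]) (k + 1)) := by
  set n := u.length + 2 with hn
  refine isChristoffel_iff_rotation.2 ⟨(k + 1) * n, (k + 1) * r, x, y, by positivity,
    Nat.mul_lt_mul_of_pos_left hrn (Nat.succ_pos k), hxy, ?_⟩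
  rw [show rotationLetter ((k + 1) * n) ((k + 1) * r) x y = rotationLetter n r x y from
    funext (rotationLetter_mul (Nat.succ_pos k) _ _ _ _),
    range_map_periodic (rotationLetter_add_self _ _ _ _), hn, range_map_add_two, ← hn,
    show rotationLetter n r x y 0 = x by simp [rotationLetter, hrn],
    show rotationLetter n r x y (u.length + 1) = y by
      have := pred_mul_mod hr hrn
      rw [show n - 1 = u.length + 1 by omega] at this
      simp [rotationLetter, this]]
  have e : u = (List.range u.length).map fun i => rotationLetter n r x y (i + 1) :=
    hu.trans (List.map_congr_left fun i hi => h _ (Nat.succ_pos i) (by simpa using hi))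
  rw [← e]

theorem isChristoffel_wordPow_of_isCentral {u : Word} (hu : IsCentral u) {x y : Letter}
    (hxy : x ≠ y) (k : ℕ) : IsChristoffel (wordPow ([x] ++ u ++ [y]) (k + 1)) := by
  obtain ⟨p, q, ⟨hp0, hp⟩, ⟨hq0, hq⟩, hpq, hlen⟩ := hu
  set n := u.length + 2 with hn
  set U : ℕ → Letter := fun i => u.getD (i - 1) x with hU
  have hmap : u = (List.range u.length).map fun i => U (i + 1) := by
    refine List.ext_getElem (by simp) fun i h1 h2 => ?_
    simp [hU, h1]
  have hper : ∀ d, List.HasPeriod u d → ∀ i, 0 < i → i + d < n - 1 → U i = U (i + d) := by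
    intro d hd i hi hid
    rw [List.hasPeriod_iff_getElem?] at hd
    have := hd (i - 1) (by omega)
    simp only [hU, List.getD_eq_getElem?_getD]
    rw [this, show i - 1 + d = i + d - 1 by omega]
  have hpn : Nat.Coprime p n := by rw [hlen]; simpa using hpq
  obtain ⟨r, hrn, hr⟩ := Nat.exists_mul_mod_eq_one_of_coprime hpn (by omega)
  have hr0 : 0 < r := Nat.pos_of_ne_zero fun e => by simp [e] at hr
  have hcop : Nat.Coprime n r := (Nat.coprime_of_mul_modEq_one p
    (by rw [mul_comm, Nat.ModEq, hr, Nat.mod_eq_of_lt (by omega)])).symm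
  have hqr : (q * r) % n = n - 1 := by
    have h1 : q * r + p * r ≡ (n - 1) + p * r [MOD n] := by
      rw [← Nat.add_mul, show q + p = n by omega]
      refine Nat.ModEq.trans (b := 0) (by simp [Nat.ModEq]) ?_
      have h2 : p * r ≡ 1 [MOD n] := by
        rw [Nat.ModEq, hr, Nat.mod_eq_of_lt (by omega)]
      refine Nat.ModEq.trans ?_ (h2.add_left (n - 1)).symm
      rw [show n - 1 + 1 = n by omega]
      simp [Nat.ModEq]
    have h3 := Nat.ModEq.add_right_cancel' _ h1
    rwa [Nat.ModEq, Nat.mod_eq_of_lt (show n - 1 < n by omega)] at h3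
  have hq' : (q * (n - r)) % n = 1 := by
    rw [mul_sub_mod hrn (by omega), hqr]
    omega
  have hUp := hper p hp
  have hUq := hper q hq
  have key := eq_rotationLetter_of_periods hlen.symm hr hq' hcop hr0 hrn hUp hUq
  have key' := eq_rotationLetter_of_periods (p := q) (q := p) (r := n - r) (by omega) hq'
    (by rwa [Nat.sub_sub_self hrn.le]) ((Nat.coprime_self_sub_right hrn.le).2 hcop) (by omega)
    (by omega) hUq hUp
  have hdich : ∀ z : Letter, z = x ∨ z = y := by
    intro z
    cases x <;> cases y <;> cases z <;> first | exact absurd rfl hxy | decide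
  -- if the two arcs carry the same letter, `u` is constant and `r` is taken to be `1` or `n - 1`
  rcases hdich (U p) with ep | ep <;> rcases hdich (U q) with eq | eq
  · refine isChristoffel_of_letters hmap hxy one_pos (by omega) (fun i hi hin => ?_) k
    rw [key i hi (by omega), ep, eq]
    have : i % (u.length + 2) = i := Nat.mod_eq_of_lt (by omega)
    simp [rotationLetter, this, hin]
  · refine isChristoffel_of_letters hmap hxy hr0 hrn (fun i hi hin => ?_) k
    rw [key i hi (by omega), ep, eq]
  · refine isChristoffel_of_letters hmap hxy (r := n - r) (by omega) (by omega)
      (fun i hi hin => ?_) k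
    rw [key' i hi (by omega), ep, eq]
  · refine isChristoffel_of_letters hmap hxy (r := n - 1) (by omega) (by omega)
      (fun i hi hin => ?_) k
    rw [key i hi (by omega), ep, eq]
    have := mul_mod_ne (r := n - 1) ((Nat.coprime_self_sub_right (by omega)).2 (by simp))
      (by omega) hi (show i < n - 1 by omega)
    unfold rotationLetter
    rw [ite_self, if_neg (by rw [← hn]; omega)]

end Words

theorem theorem3 :
    Words.BS =
        {w : Words.Word | ∃ x y : Words.Letter, Words.IsChristoffel ([x] ++ w ++ [y])} ∧
      Words.BS =
        {w : Words.Word | ∃ (u : Words.Word) (n : ℕ) (x y : Words.Letter),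
          Words.IsCentral u ∧ x ≠ y ∧ w = Words.wordPow (u ++ [y, x]) n ++ u} := by
  have h : ∀ w, w ∈ Words.BS ↔ ∃ x y, Words.IsChristoffel ([x] ++ w ++ [y]) := fun w =>
    ⟨Words.exists_isChristoffel_of_mem_BS, fun ⟨_, _, hw⟩ => Words.mem_BS_of_isChristoffel hw⟩
  refine ⟨Set.ext h, Set.ext fun w => (h w).trans ⟨?_, ?_⟩⟩
  · rintro ⟨x, y, hw⟩
    exact Words.exists_central_of_isChristoffel hw
  · rintro ⟨u, n, x, y, hu, hxy, rfl⟩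
    refine ⟨x, y, ?_⟩
    rw [Words.conj_wordPow]
    exact Words.isChristoffel_wordPow_of_isCentral hu hxy n
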